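/- Let $\mathbf A\in\mathbb R^{m\times d}$ have rank $d\ge 1$ and singular value decomposition $\mathbf A=\mathbf U\mathbf S\mathbf V^{T}$, where $\mathbf U\in\mathbb R^{m\times d}$ has orthonormal columns and rows $\mathbf u_1^T,\dots,\mathbf u_m^T$, $\mathbf S\in\mathbb R^{d\times d}$ is positive diagonal, and $\mathbf V\in\mathbb R^{d\times d}$ is orthogonal. Let $\mathbf y\in\mathbb R^m$, let ${}^+$ denote the Moore–Penrose pseudo-inverse and $\|\cdot\|$ the Euclidean norm, let $\mathbf x^*=\mathbf A^+\mathbf y$ and let $\boldsymbol\epsilon=\mathbf y-\mathbf A\mathbf A^+\mathbf y$ be the residual, with entries $\epsilon_t$. Let $\beta\in(0,1]$, $\epsilon\in(0,1)$ and $\delta>0$. Let $p_1,\dots,p_m\ge 0$ with $\sum_t p_t=1$ satisfy, for all $t$, $$p_t\ \ge\ \beta\left(\frac{\|\mathbf u_t\|^2}{d}+\frac{\|\mathbf u_t\|^2+\epsilon_t^2/\|\boldsymbol\epsilon\|^2}{d+1}+\frac{\epsilon_t^2}{\|\boldsymbol\epsilon\|^2}\right),$$ where $\epsilon_t^2/\|\boldsymbol\epsilon\|^2$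 is read as $0$ if $\boldsymbol\epsilon=0$. Let $t_1,\dots,t_r$ be independent random indices with $\Pr[t_j=t]=p_t$, and let $\mathbf Q\in\mathbb R^{r\times m}$ be the row-sampling matrix whose $j$-th row is $\mathbf e_{t_j}^T/\sqrt{r\,p_{t_j}}$. Then $\mathbf x^*$ is an optimal least-squares solution, i.e. $\|\mathbf A\mathbf x^*-\mathbf y\|\le\|\mathbf A\mathbf x-\mathbf y\|$ for all $\mathbf x\in\mathbb R^d$, and, if $$r\ \ge\ \frac{8(d+1)}{\beta\epsilon^2}\ln\frac{2(d+1)}{\delta},$$ then $\hat{\mathbf x}=(\mathbf Q\mathbf A)^+\mathbf Q\mathbf y$ satisfies, with probability at least $1-3\delta$, $$\|\mathbf A\hat{\mathbf x}-\mathbf y\|\ \le\ \left(1+\epsilon+\epsilon\sqrt{\frac{1+\epsilon}{1-\epsilon}}\right)\|\mathbf A\mathbf x^*-\mathbf y\|.$$ -/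

import Mathlib

open scoped Matrix

noncomputable section

/-- The Moore–Penrose pseudo-inverse `A⁺ = (AᵀA)⁺ Aᵀ` of a real matrix. The pseudo-inverse of the
symmetric matrix `AᵀA` is read off from its spectral decomposition by inverting the nonzero
eigenvalues (recall `0⁻¹ = 0`). See `pinv_isMoorePenrose` for the four Penrose conditions and
`IsMoorePenrose.unique` for the fact that they determine it. -/
def pinv {m n : ℕ} (A : Matrix (Fin m) (Fin n) ℝ) : Matrix (Fin n) (Fin m) ℝ :=
  let h : (Aᵀ * A).IsHermitian := Matrix.isHermitian_conjTranspose_mul_self A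
  (h.eigenvectorUnitary : Matrix (Fin n) (Fin n) ℝ) *
    Matrix.diagonal (fun i => (h.eigenvalues i)⁻¹) *
    (h.eigenvectorUnitary : Matrix (Fin n) (Fin n) ℝ)ᵀ * Aᵀ

/-- The four Penrose conditions. -/
structure IsMoorePenrose {m n : ℕ} (A : Matrix (Fin m) (Fin n) ℝ)
    (X : Matrix (Fin n) (Fin m) ℝ) : Prop where
  mul_mul_self : A * X * A = A
  self_mul_mul : X * A * X = X
  symm_left : (A * X)ᵀ = A * X
  symm_right : (X * A)ᵀ = X * A

theorem pinv_isMoorePenrose {m n : ℕ} (A : Matrix (Fin m) (Fin n) ℝ) :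
    IsMoorePenrose A (pinv A) := by
  have h : (Aᵀ * A).IsHermitian := Matrix.isHermitian_conjTranspose_mul_self A
  obtain ⟨W, hW⟩ : ∃ W : Matrix (Fin n) (Fin n) ℝ,
    W = (h.eigenvectorUnitary : Matrix (Fin n) (Fin n) ℝ) := ⟨_, rfl⟩
  obtain ⟨e, he⟩ : ∃ e : Fin n → ℝ, e = h.eigenvalues := ⟨_, rfl⟩
  have hWW : Wᵀ * W = 1 := by
    rw [hW]; exact Matrix.mem_unitaryGroup_iff'.1 h.eigenvectorUnitary.2
  have hB : Aᵀ * A = W * Matrix.diagonal e * Wᵀ := by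
    have := h.spectral_theorem
    rw [Unitary.conjStarAlgAut_apply] at this
    rw [hW, he]
    exact this
  obtain ⟨P, hP⟩ : ∃ P, P = W * Matrix.diagonal (fun i => (e i)⁻¹) * Wᵀ := ⟨_, rfl⟩
  have hpinv : pinv A = P * Aᵀ := by rw [hP, hW, he]; rfl
  have key : ∀ a b : Fin n → ℝ, W * Matrix.diagonal a * Wᵀ * (W * Matrix.diagonal b * Wᵀ) =
      W * Matrix.diagonal (fun i => a i * b i) * Wᵀ := by
    intro a b
    calc _ = W * Matrix.diagonal a * (Wᵀ * W) * Matrix.diagonal b * Wᵀ := by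
            simp only [Matrix.mul_assoc]
      _ = _ := by rw [hWW, Matrix.mul_one, Matrix.mul_assoc W, Matrix.diagonal_mul_diagonal]
  have hsymm : ∀ a : Fin n → ℝ, (W * Matrix.diagonal a * Wᵀ)ᵀ = W * Matrix.diagonal a * Wᵀ := by
    intro a
    simp [Matrix.transpose_mul, Matrix.mul_assoc]
  have hPt : Pᵀ = P := by rw [hP]; exact hsymm _
  have hPB : P * (Aᵀ * A) =
      W * Matrix.diagonal (fun i => (e i)⁻¹ * e i) * Wᵀ := by
    rw [hB, hP, key]
  have hPBt : (P * (Aᵀ * A))ᵀ = P * (Aᵀ * A) := by rw [hPB]; exact hsymm _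
  have hPBP : P * (Aᵀ * A) * P = P := by
    rw [hPB]
    conv_lhs => rw [hP]
    rw [key, hP]
    congr 3
    funext i
    by_cases hi : e i = 0 <;> simp [hi]
  have hBPB : Aᵀ * A * (P * (Aᵀ * A)) = Aᵀ * A := by
    rw [hPB]
    conv_lhs => rw [hB]
    rw [key]
    conv_rhs => rw [hB]
    congr 3
    funext i
    by_cases hi : e i = 0 <;> simp [hi]
  have hAPB : A * (P * (Aᵀ * A)) = A := by
    rw [← sub_eq_zero, ← Matrix.conjTranspose_mul_self_eq_zero,
      Matrix.conjTranspose_eq_transpose_of_trivial,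
      Matrix.transpose_sub, Matrix.transpose_mul, hPBt]
    have e1 : P * (Aᵀ * A) * Aᵀ * (A * (P * (Aᵀ * A))) =
        P * (Aᵀ * A) * (Aᵀ * A * (P * (Aᵀ * A))) := by simp only [Matrix.mul_assoc]
    have e2 : Aᵀ * (A * (P * (Aᵀ * A))) = Aᵀ * A := by rw [← Matrix.mul_assoc, hBPB]
    have e3 : P * (Aᵀ * A) * Aᵀ * A = P * (Aᵀ * A) * (Aᵀ * A) := by simp only [Matrix.mul_assoc]
    rw [Matrix.sub_mul, Matrix.mul_sub, Matrix.mul_sub, e1, hBPB, e2, e3]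
    simp
  refine ⟨?_, ?_, ?_, ?_⟩
  · rw [hpinv, Matrix.mul_assoc, Matrix.mul_assoc, hAPB]
  · rw [hpinv]
    calc P * Aᵀ * A * (P * Aᵀ) = P * (Aᵀ * A) * P * Aᵀ := by simp only [Matrix.mul_assoc]
      _ = _ := by rw [hPBP]
  · rw [hpinv]
    simp [Matrix.transpose_mul, hPt, Matrix.mul_assoc]
  · rw [hpinv, Matrix.mul_assoc, hPBt]

theorem IsMoorePenrose.unique {m n : ℕ} {A : Matrix (Fin m) (Fin n) ℝ}
    {X Y : Matrix (Fin n) (Fin m) ℝ} (hX : IsMoorePenrose A X) (hY : IsMoorePenrose A Y) :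
    X = Y := by
  have e1 : A * X = A * Y := by
    calc A * X = (A * X)ᵀ := hX.symm_left.symm
      _ = (A * Y * (A * X))ᵀ := by rw [← Matrix.mul_assoc, hY.mul_mul_self]
      _ = A * X * (A * Y) := by rw [Matrix.transpose_mul, hX.symm_left, hY.symm_left]
      _ = A * Y := by rw [← Matrix.mul_assoc, hX.mul_mul_self]
  have e2 : X * A = Y * A := by
    calc X * A = X * (A * Y * A) := by rw [hY.mul_mul_self]
      _ = X * A * (Y * A) := by simp only [Matrix.mul_assoc]
      _ = (Y * A * (X * A))ᵀ := by rw [Matrix.transpose_mul, hX.symm_right, hY.symm_right]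
      _ = (Y * (A * X * A))ᵀ := by simp only [Matrix.mul_assoc]
      _ = Y * A := by rw [hX.mul_mul_self, hY.symm_right]
  calc X = X * A * X := hX.self_mul_mul.symm
    _ = Y * (A * X) := by rw [e2, Matrix.mul_assoc]
    _ = Y := by rw [e1, ← Matrix.mul_assoc, hY.self_mul_mul]

/-- The Euclidean norm of a vector of `ℝᵐ` given by its coordinates. -/
def euclNorm {m : ℕ} (v : Fin m → ℝ) : ℝ := ‖WithLp.toLp 2 v‖

/-- The residual `y - A A⁺ y` of least-squares regression. -/
def lsResidual {m d : ℕ} (A : Matrix (Fin m) (Fin d) ℝ) (y : Fin m → ℝ) : Fin m → ℝ :=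
  y - A *ᵥ (pinv A *ᵥ y)

/-- `A = U diag(σ) Vᵀ` is a (thin) singular value decomposition of a matrix with full column rank:
`U` has orthonormal columns, `V` is orthogonal and the singular values are positive. -/
structure IsSVD {m d : ℕ} (A : Matrix (Fin m) (Fin d) ℝ) (U : Matrix (Fin m) (Fin d) ℝ)
    (σ : Fin d → ℝ) (V : Matrix (Fin d) (Fin d) ℝ) : Prop where
  eq : A = U * Matrix.diagonal σ * Vᵀ
  orthonormal_left : Uᵀ * U = 1
  orthogonal_right : Vᵀ * V = 1
  pos : ∀ i, 0 < σ i

/-- The row-sampling matrix whose `j`-th row is `e_{t j} / √(r p_{t j})`. -/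
def rowSamplingMatrix {m r : ℕ} (p : Fin m → ℝ) (t : Fin r → Fin m) :
    Matrix (Fin r) (Fin m) ℝ :=
  Matrix.of fun j i => if i = t j then 1 / √(r * p (t j)) else 0

/-- The approximate regression `x̂ = (Q A)⁺ Q y`. -/
def sampledRegression {m d r : ℕ} (Q : Matrix (Fin r) (Fin m) ℝ) (A : Matrix (Fin m) (Fin d) ℝ)
    (y : Fin m → ℝ) : Fin d → ℝ :=
  pinv (Q * A) *ᵥ (Q *ᵥ y)

end

/-! Every residual `A x - y` lies in the span of the columns of `U` and of the optimal residual `e`,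
which is orthogonal to them. Let `W` be an orthonormal basis of this span, with at most `d + 1`
columns. Suppose sampling shrinks no squared norm on this space by more than a factor `1 - ε` and
stretches that of `e` by at most `1 + ε`. Since the sampled solution minimizes the sampled residual,
`(1 - ε)‖A x̂ - y‖² ≤ ‖Q(A x̂ - y)‖² ≤ ‖Q e‖² ≤ (1 + ε)‖e‖²`, which is stronger than the claimed
bound (`euclNorm_sampledRegression_sub_le`).

The row bound `‖W i‖² ≤ L p i` with `L = (d + 1)/β` controls both events. The upper one is a scalar
Chernoff bound (`sum_pi_upper_tail_le`). The lower one is a matrix Chernoff bound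
(`sum_pi_lower_tail_le`), obtained from neither Golden–Thompson nor Lieb but from the rank-one
inequality `trace_exp_sub_vecMulVec_le`: averaging it over one sample shrinks the trace exponential
by a fixed factor, and the samples are removed one at a time. Each event fails with probability at
most `δ`. -/

/-! ### Trace exponential under a rank-one decrement -/

theorem exp_sub_exp_ge (h k : ℝ) :
    Real.exp h - Real.exp k ≥
      (h - k) * Real.exp h - (h - k) ^ 2 * (Real.exp h + Real.exp k) / 2 := by
  rcases le_total k h with hk | hk
  · have h1 : 1 - Real.exp (k - h) ≥ (h - k) - (h - k) ^ 2 / 2 - (h - k) ^ 2 * Real.exp (k - h) / 2 := by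
      have h2 := Real.quadratic_le_exp_of_nonneg (sub_nonneg.2 hk)
      have h3 : Real.exp (k - h) * Real.exp (h - k) = 1 := by
        rw [← Real.exp_add]; simp
      have h4 := Real.exp_pos (k - h)
      have h5 : Real.exp (k - h) * (1 + (h - k) + (h - k) ^ 2 / 2) ≤ 1 :=
        (mul_le_mul_of_nonneg_left h2 h4.le).trans_eq h3
      set x := h - k
      have hx : 0 ≤ x := sub_nonneg.2 hk
      -- The product on the right is `1 + x ^ 4 / 4`, hence at least `1`.
      have h6 : Real.exp (k - h) * (1 + x + x ^ 2 / 2) ≤ (1 - x + x ^ 2 / 2) * (1 + x + x ^ 2 / 2) := by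
        nlinarith [pow_nonneg hx 4]
      have h7 : Real.exp (k - h) ≤ 1 - x + x ^ 2 / 2 := le_of_mul_le_mul_right h6 (by positivity)
      nlinarith [mul_nonneg (sq_nonneg x) h4.le]
    have h2 : Real.exp k = Real.exp h * Real.exp (k - h) := by rw [← Real.exp_add]; ring_nf
    have h3 := mul_le_mul_of_nonneg_left h1 (Real.exp_pos h).le
    rw [h2]
    linarith
  · have h1 : Real.exp (h - k) * (1 - (h - k)) ≥ 1 - (h - k) ^ 2 / 2 := by
      obtain ⟨u, hu⟩ : ∃ u, u = k - h := ⟨_, rfl⟩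
      have hu0 : 0 ≤ u := by linarith
      have hm : MonotoneOn (fun u : ℝ => Real.exp (-u) * (1 + u) + u ^ 2 / 2) (Set.Ici 0) := by
        have hd : ∀ x : ℝ, HasDerivAt (fun u : ℝ => Real.exp (-u) * (1 + u) + u ^ 2 / 2)
            (x * (1 - Real.exp (-x))) x := by
          intro x
          have := (((hasDerivAt_id x).neg.exp).mul ((hasDerivAt_id x).const_add 1)).add
            (((hasDerivAt_id x).pow 2).div_const 2)
          refine HasDerivAt.congr_deriv this ?_
          simp
          ring
        refine monotoneOn_of_deriv_nonneg (convex_Ici 0)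
          (fun x _ => (hd x).continuousAt.continuousWithinAt)
          (fun x _ => (hd x).differentiableAt.differentiableWithinAt) fun x hx => ?_
        rw [interior_Ici, Set.mem_Ioi] at hx
        rw [(hd x).deriv]
        exact mul_nonneg hx.le (sub_nonneg.2 (Real.exp_le_one_iff.2 (by linarith)))
      have h4 := hm (Set.mem_Ici.2 le_rfl) (Set.mem_Ici.2 hu0) hu0
      simp only [neg_zero, Real.exp_zero] at h4
      rw [show h - k = -u by linarith]
      linarith
    have h2 : Real.exp h = Real.exp k * Real.exp (h - k) := by rw [← Real.exp_add]; ring_nf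
    have h3 := mul_le_mul_of_nonneg_left h1 (Real.exp_pos k).le
    have h4 : 0 ≤ (h - k) ^ 2 * Real.exp h := by positivity
    have h5 : Real.exp k * (Real.exp (h - k) * (1 - (h - k))) = Real.exp h * (1 - (h - k)) := by
      rw [h2]; ring
    rw [h5] at h3
    linarith

/-- The weights `C i j ^ 2` are doubly stochastic, so both exponential sums become double sums and
`exp_sub_exp_ge` applies termwise. The coupling relation turns the first-order term into `∑ exp (h
i) * a i ^ 2`, and each second-order term into `s` times a sum of this kind. -/
theorem sum_exp_le_of_rank_one_coupling {n : Type*} [Fintype n] (h k a b : n → ℝ)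
    (C : Matrix n n ℝ) (s : ℝ) (hrow : ∀ i, ∑ j, C i j ^ 2 = 1) (hcol : ∀ j, ∑ i, C i j ^ 2 = 1)
    (hCb : ∀ i, ∑ j, C i j * b j = a i) (hCa : ∀ j, ∑ i, C i j * a i = b j)
    (hC : ∀ i j, (h i - k j) * C i j = a i * b j)
    (ha : ∑ i, a i ^ 2 = s) (hb : ∑ j, b j ^ 2 = s) :
    ∑ j, Real.exp (k j) ≤ ∑ i, Real.exp (h i) - (1 - s) * ∑ i, Real.exp (h i) * a i ^ 2 := by
  have hs : 0 ≤ s := by rw [← ha]; positivity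
  have eh : ∑ i, ∑ j, C i j ^ 2 * Real.exp (h i) = ∑ i, Real.exp (h i) := by
    simp_rw [← Finset.sum_mul, hrow, one_mul]
  have ek : ∑ i, ∑ j, C i j ^ 2 * Real.exp (k j) = ∑ j, Real.exp (k j) := by
    rw [Finset.sum_comm]
    simp_rw [← Finset.sum_mul, hcol, one_mul]
  have e1 : ∀ i j, C i j ^ 2 * (h i - k j) = C i j * b j * a i := fun i j => by
    linear_combination C i j * hC i j
  have e2 : ∀ i j, C i j ^ 2 * (h i - k j) ^ 2 = a i ^ 2 * b j ^ 2 := fun i j => by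
    rw [← mul_pow, ← mul_pow, ← hC i j]; ring
  have e1h : ∑ i, ∑ j, C i j ^ 2 * (h i - k j) * Real.exp (h i)
      = ∑ i, Real.exp (h i) * a i ^ 2 := by
    simp_rw [e1, ← Finset.sum_mul, hCb]
    exact Finset.sum_congr rfl fun i _ => by ring
  have e1k : ∑ i, ∑ j, C i j ^ 2 * (h i - k j) * Real.exp (k j)
      = ∑ j, Real.exp (k j) * b j ^ 2 := by
    rw [Finset.sum_comm]
    refine Finset.sum_congr rfl fun j _ => ?_
    rw [← Finset.sum_mul]
    simp_rw [e1]
    rw [show ∑ i, C i j * b j * a i = b j * ∑ i, C i j * a i by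
      rw [Finset.mul_sum]; exact Finset.sum_congr rfl fun i _ => by ring]
    rw [hCa]
    ring
  have e2h : ∑ i, ∑ j, C i j ^ 2 * (h i - k j) ^ 2 * Real.exp (h i)
      = s * ∑ i, Real.exp (h i) * a i ^ 2 := by
    simp_rw [e2, ← Finset.sum_mul, ← Finset.mul_sum, hb]
    rw [Finset.mul_sum]
    exact Finset.sum_congr rfl fun i _ => by ring
  have e2k : ∑ i, ∑ j, C i j ^ 2 * (h i - k j) ^ 2 * Real.exp (k j)
      = s * ∑ j, Real.exp (k j) * b j ^ 2 := by
    rw [Finset.sum_comm]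
    simp_rw [e2, ← Finset.sum_mul, ha]
    rw [Finset.mul_sum]
    exact Finset.sum_congr rfl fun i _ => by ring
  -- Monotonicity of `exp` bounds the second-order term in `k` by the one in `h`, so that their
  -- average costs at most a factor `s`.
  have hmono : ∑ j, Real.exp (k j) * b j ^ 2 ≤ ∑ i, Real.exp (h i) * a i ^ 2 := by
    rw [← e1h, ← e1k]
    refine Finset.sum_le_sum fun i _ => Finset.sum_le_sum fun j _ => ?_
    have : 0 ≤ (h i - k j) * (Real.exp (h i) - Real.exp (k j)) := by
      rcases le_total (h i) (k j) with hh | hh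
      · exact mul_nonneg_of_nonpos_of_nonpos (by linarith) (by linarith [Real.exp_le_exp.2 hh])
      · exact mul_nonneg (by linarith) (by linarith [Real.exp_le_exp.2 hh])
    linarith [mul_nonneg (sq_nonneg (C i j)) this]
  have hmain : ∑ i, ∑ j, C i j ^ 2 * (h i - k j) * Real.exp (h i)
      - (∑ i, ∑ j, C i j ^ 2 * (h i - k j) ^ 2 * Real.exp (h i)
        + ∑ i, ∑ j, C i j ^ 2 * (h i - k j) ^ 2 * Real.exp (k j)) / 2
      ≤ ∑ i, ∑ j, C i j ^ 2 * Real.exp (h i) - ∑ i, ∑ j, C i j ^ 2 * Real.exp (k j) := by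
    simp only [← Finset.sum_add_distrib, ← Finset.sum_sub_distrib, Finset.sum_div]
    refine Finset.sum_le_sum fun i _ => Finset.sum_le_sum fun j _ => ?_
    linarith [mul_le_mul_of_nonneg_left (exp_sub_exp_ge (h i) (k j)) (sq_nonneg (C i j))]
  rw [e1h, e2h, e2k, eh, ek] at hmain
  linarith [mul_le_mul_of_nonneg_left hmono hs]

theorem Matrix.IsHermitian.exists_orthogonal_diagonal {n : Type*} [Fintype n] [DecidableEq n]
    {H : Matrix n n ℝ} (hH : H.IsHermitian) :
    ∃ (Q : Matrix n n ℝ) (h : n → ℝ), Qᵀ * Q = 1 ∧ Q * Qᵀ = 1 ∧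
      H = Q * Matrix.diagonal h * Qᵀ := by
  refine ⟨hH.eigenvectorUnitary, hH.eigenvalues,
    Matrix.mem_unitaryGroup_iff'.1 hH.eigenvectorUnitary.2,
    Matrix.mem_unitaryGroup_iff.1 hH.eigenvectorUnitary.2, ?_⟩
  have := hH.spectral_theorem
  rw [Unitary.conjStarAlgAut_apply] at this
  exact this

theorem exp_orthogonal_conj_diagonal {n : Type*} [Fintype n] [DecidableEq n]
    {Q : Matrix n n ℝ} (h : n → ℝ) (hQ : Q * Qᵀ = 1) :
    NormedSpace.exp (Q * Matrix.diagonal h * Qᵀ)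
      = Q * Matrix.diagonal (fun i => Real.exp (h i)) * Qᵀ := by
  have hQi : Q⁻¹ = Qᵀ := Matrix.inv_eq_right_inv hQ
  have hu : IsUnit Q := ⟨⟨Q, Qᵀ, hQ, mul_eq_one_comm.1 hQ⟩, rfl⟩
  rw [← hQi, Matrix.exp_conj _ _ hu, Matrix.exp_diagonal]
  congr 3
  funext i
  rw [Pi.coe_exp, Real.exp_eq_exp_ℝ]

theorem dotProduct_conj_diagonal_mulVec {n : Type*} [Fintype n] [DecidableEq n]
    (Q : Matrix n n ℝ) (c v : n → ℝ) :
    v ⬝ᵥ (Q * Matrix.diagonal c * Qᵀ) *ᵥ v = ∑ i, c i * (Qᵀ *ᵥ v) i ^ 2 := by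
  rw [← Matrix.mulVec_mulVec, ← Matrix.mulVec_mulVec, Matrix.dotProduct_mulVec,
    ← Matrix.mulVec_transpose, dotProduct]
  refine Finset.sum_congr rfl fun i _ => ?_
  rw [Matrix.mulVec_diagonal]
  ring

theorem sum_mulVec_sq_of_orthogonal {n : Type*} [Fintype n] [DecidableEq n]
    {Q : Matrix n n ℝ} (hQ : Q * Qᵀ = 1) (v : n → ℝ) :
    ∑ i, (Qᵀ *ᵥ v) i ^ 2 = v ⬝ᵥ v := by
  have := dotProduct_conj_diagonal_mulVec Q (fun _ => 1) v
  simpa [hQ] using this.symm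

theorem trace_conj_diagonal {n : Type*} [Fintype n] [DecidableEq n]
    {Q : Matrix n n ℝ} (hQ : Qᵀ * Q = 1) (c : n → ℝ) :
    (Q * Matrix.diagonal c * Qᵀ).trace = ∑ i, c i := by
  rw [Matrix.trace_mul_comm, ← Matrix.mul_assoc, hQ, Matrix.one_mul, Matrix.trace_diagonal]

/-- With eigenbases `Q` of `H` and `R` of `H - v vᵀ`, the overlap matrix `Qᵀ R` is orthogonal and
links the two spectra through the rank-one matrix `(Qᵀ v)(Rᵀ v)ᵀ`. This reduces the claim to
scalars. -/
theorem trace_exp_sub_vecMulVec_le {n : Type*} [Fintype n] [DecidableEq n]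
    {H : Matrix n n ℝ} (hH : H.IsHermitian) (v : n → ℝ) :
    (NormedSpace.exp (H - Matrix.vecMulVec v v)).trace ≤
      (NormedSpace.exp H).trace - (1 - v ⬝ᵥ v) * (v ⬝ᵥ NormedSpace.exp H *ᵥ v) := by
  have hvv : (Matrix.vecMulVec v v).IsHermitian := by
    ext i j; simp [Matrix.vecMulVec_apply, mul_comm]
  obtain ⟨Q, h, hQ, hQ', hHQ⟩ := hH.exists_orthogonal_diagonal
  obtain ⟨R, k, hR, hR', hKR⟩ := (hH.sub hvv).exists_orthogonal_diagonal
  rw [hKR, hHQ, exp_orthogonal_conj_diagonal _ hQ', exp_orthogonal_conj_diagonal _ hR',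
    trace_conj_diagonal hQ, trace_conj_diagonal hR, dotProduct_conj_diagonal_mulVec]
  have hCC : (Qᵀ * R) * (Qᵀ * R)ᵀ = 1 := by
    rw [Matrix.transpose_mul, Matrix.transpose_transpose, Matrix.mul_assoc, ← Matrix.mul_assoc R,
      hR', Matrix.one_mul, hQ]
  have hCC' : (Qᵀ * R)ᵀ * (Qᵀ * R) = 1 := mul_eq_one_comm.1 hCC
  have hrel : Matrix.diagonal h * (Qᵀ * R) - (Qᵀ * R) * Matrix.diagonal k
      = Matrix.vecMulVec (Qᵀ *ᵥ v) (Rᵀ *ᵥ v) := by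
    have e1 : Matrix.diagonal h * (Qᵀ * R) = Qᵀ * H * R := by
      rw [hHQ]
      calc _ = (1 : Matrix n n ℝ) * Matrix.diagonal h * Qᵀ * R := by
            simp only [Matrix.mul_assoc, Matrix.one_mul]
        _ = _ := by rw [← hQ]; simp only [Matrix.mul_assoc]
    have e2 : (Qᵀ * R) * Matrix.diagonal k = Qᵀ * (H - Matrix.vecMulVec v v) * R := by
      rw [hKR]
      calc _ = Qᵀ * R * Matrix.diagonal k * (1 : Matrix n n ℝ) := by
            simp only [Matrix.mul_assoc, Matrix.mul_one]
        _ = _ := by rw [← hR]; simp only [Matrix.mul_assoc]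
    rw [e1, e2, ← Matrix.sub_mul, ← Matrix.mul_sub, sub_sub_cancel, Matrix.mul_vecMulVec,
      Matrix.vecMulVec_mul, ← Matrix.mulVec_transpose]
  refine sum_exp_le_of_rank_one_coupling h k (Qᵀ *ᵥ v) (Rᵀ *ᵥ v) (Qᵀ * R) (v ⬝ᵥ v) ?_ ?_ ?_ ?_ ?_
    (sum_mulVec_sq_of_orthogonal hQ' v) (sum_mulVec_sq_of_orthogonal hR' v)
  · intro i
    have := congrFun (congrFun hCC i) i
    rw [Matrix.mul_apply, Matrix.one_apply_eq] at this
    simpa [sq] using this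
  · intro j
    have := congrFun (congrFun hCC' j) j
    rw [Matrix.mul_apply, Matrix.one_apply_eq] at this
    simpa [sq] using this
  · intro i
    change ((Qᵀ * R) *ᵥ (Rᵀ *ᵥ v)) i = _
    rw [Matrix.mulVec_mulVec, Matrix.mul_assoc, hR', Matrix.mul_one]
  · intro j
    change ((Qᵀ * R)ᵀ *ᵥ (Qᵀ *ᵥ v)) j = _
    rw [Matrix.mulVec_mulVec, Matrix.transpose_mul, Matrix.transpose_transpose, Matrix.mul_assoc,
      hQ', Matrix.mul_one]
  · intro i j
    have := congrFun (congrFun hrel i) j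
    rw [Matrix.sub_apply, Matrix.diagonal_mul, Matrix.mul_diagonal, Matrix.vecMulVec_apply] at this
    linarith

/-- Some eigenvalue of `H` is at least `c`, and its exponential is one of the positive terms of the
trace. Strictness in `hx` excludes `x = 0`. -/
theorem exp_le_trace_exp {n : Type*} [Fintype n] [DecidableEq n]
    {H : Matrix n n ℝ} (hH : H.IsHermitian) (x : n → ℝ) (c : ℝ)
    (hx : c * (x ⬝ᵥ x) < x ⬝ᵥ H *ᵥ x) :
    Real.exp c ≤ (NormedSpace.exp H).trace := by
  obtain ⟨Q, h, hQ, hQ', hHQ⟩ := hH.exists_orthogonal_diagonal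
  rw [hHQ, dotProduct_conj_diagonal_mulVec, ← sum_mulVec_sq_of_orthogonal hQ', Finset.mul_sum] at hx
  obtain ⟨i, -, hi⟩ := Finset.exists_lt_of_sum_lt hx
  rw [hHQ, exp_orthogonal_conj_diagonal _ hQ', trace_conj_diagonal hQ]
  have hci : c ≤ h i := by
    by_contra! hlt
    exact absurd hi (not_lt.2 (mul_le_mul_of_nonneg_right hlt.le (sq_nonneg _)))
  calc Real.exp c ≤ Real.exp (h i) := Real.exp_le_exp.2 hci
    _ ≤ _ := Finset.single_le_sum (f := fun i => Real.exp (h i))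
      (fun _ _ => (Real.exp_pos _).le) (Finset.mem_univ i)

theorem trace_exp_nonneg {n : Type*} [Fintype n] [DecidableEq n]
    {H : Matrix n n ℝ} (hH : H.IsHermitian) : 0 ≤ (NormedSpace.exp H).trace := by
  obtain ⟨Q, h, hQ, hQ', hHQ⟩ := hH.exists_orthogonal_diagonal
  rw [hHQ, exp_orthogonal_conj_diagonal _ hQ', trace_conj_diagonal hQ]
  positivity

theorem dotProduct_exp_mulVec_nonneg {n : Type*} [Fintype n] [DecidableEq n]
    {H : Matrix n n ℝ} (hH : H.IsHermitian) (v : n → ℝ) : 0 ≤ v ⬝ᵥ NormedSpace.exp H *ᵥ v := by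
  obtain ⟨Q, h, hQ, hQ', hHQ⟩ := hH.exists_orthogonal_diagonal
  rw [hHQ, exp_orthogonal_conj_diagonal _ hQ', dotProduct_conj_diagonal_mulVec]
  positivity

/-! ### Averaging over independent samples -/

theorem dotProduct_mulVec_self_eq_trace {n : Type*} [Fintype n] (E : Matrix n n ℝ) (v : n → ℝ) :
    v ⬝ᵥ E *ᵥ v = (E * Matrix.vecMulVec v v).trace := by
  rw [Matrix.mul_vecMulVec, Matrix.trace_vecMulVec, dotProduct_comm]

/-- Isotropy of the `v i` turns the averaged quadratic form of `exp H` into `c` times its trace;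
then `1 + x ≤ exp x`. -/
theorem sum_mul_trace_exp_sub_vecMulVec_le {κ n : Type*} [Fintype κ] [Fintype n] [DecidableEq n]
    {p : κ → ℝ} (hp0 : ∀ i, 0 ≤ p i) (hp1 : ∑ i, p i = 1) {v : κ → n → ℝ} {s c : ℝ}
    (hv : ∀ i, v i ⬝ᵥ v i ≤ s) (hI : ∑ i, p i • Matrix.vecMulVec (v i) (v i) = c • 1)
    {H : Matrix n n ℝ} (hH : H.IsHermitian) :
    ∑ i, p i * (NormedSpace.exp (H - Matrix.vecMulVec (v i) (v i))).trace
      ≤ Real.exp (-((1 - s) * c)) * (NormedSpace.exp H).trace := by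
  have key : ∑ i, p i * (v i ⬝ᵥ NormedSpace.exp H *ᵥ v i) = c * (NormedSpace.exp H).trace := by
    simp_rw [dotProduct_mulVec_self_eq_trace, ← smul_eq_mul (p _), ← Matrix.trace_smul,
      ← Matrix.mul_smul]
    rw [← Matrix.trace_sum, ← Matrix.mul_sum, hI]
    simp
  calc ∑ i, p i * (NormedSpace.exp (H - Matrix.vecMulVec (v i) (v i))).trace
      ≤ ∑ i, (p i * (NormedSpace.exp H).trace
          - (1 - s) * (p i * (v i ⬝ᵥ NormedSpace.exp H *ᵥ v i))) := by
        refine Finset.sum_le_sum fun i _ => ?_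
        have h1 := trace_exp_sub_vecMulVec_le hH (v i)
        have h2 := mul_le_mul_of_nonneg_right (hv i) (dotProduct_exp_mulVec_nonneg hH (v i))
        have h3 : (NormedSpace.exp (H - Matrix.vecMulVec (v i) (v i))).trace
            ≤ (NormedSpace.exp H).trace - (1 - s) * (v i ⬝ᵥ NormedSpace.exp H *ᵥ v i) := by linarith
        linarith [mul_le_mul_of_nonneg_left h3 (hp0 i)]
    _ = (-((1 - s) * c) + 1) * (NormedSpace.exp H).trace := by
        rw [Finset.sum_sub_distrib, ← Finset.sum_mul, hp1, ← Finset.mul_sum, key]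
        ring
    _ ≤ _ := mul_le_mul_of_nonneg_right (Real.add_one_le_exp _) (trace_exp_nonneg hH)

theorem isHermitian_sum_vecMulVec {ι n : Type*} (s : Finset ι) (v : ι → n → ℝ) :
    (∑ j ∈ s, Matrix.vecMulVec (v j) (v j)).IsHermitian := by
  ext a b
  simp [Matrix.sum_apply, Matrix.vecMulVec_apply, mul_comm]

/-- Induction on `r`: with the other samples fixed and absorbed into `H`, the one-sample bound
averages out the first. -/
theorem sum_pi_mul_trace_exp_le {κ n : Type*} [Fintype κ] [Fintype n] [DecidableEq n]
    {p : κ → ℝ} (hp0 : ∀ i, 0 ≤ p i) (hp1 : ∑ i, p i = 1) {v : κ → n → ℝ} {s c : ℝ}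
    (hv : ∀ i, v i ⬝ᵥ v i ≤ s) (hI : ∑ i, p i • Matrix.vecMulVec (v i) (v i) = c • 1) (r : ℕ)
    {H : Matrix n n ℝ} (hH : H.IsHermitian) :
    ∑ τ : Fin r → κ, (∏ j, p (τ j)) *
        (NormedSpace.exp (H - ∑ j, Matrix.vecMulVec (v (τ j)) (v (τ j)))).trace
      ≤ Real.exp (r * (-((1 - s) * c))) * (NormedSpace.exp H).trace := by
  induction r with
  | zero => simp
  | succ r ih =>
    rw [← (Fin.consEquiv fun _ => κ).sum_comp, Fintype.sum_prod_type_right]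
    have hstep : ∀ σ : Fin r → κ, ∑ i, (∏ j, p (Fin.cons (α := fun _ => κ) i σ j)) *
        (NormedSpace.exp (H - ∑ j, Matrix.vecMulVec (v (Fin.cons (α := fun _ => κ) i σ j))
          (v (Fin.cons (α := fun _ => κ) i σ j)))).trace
        ≤ Real.exp (-((1 - s) * c)) * ((∏ j, p (σ j)) *
        (NormedSpace.exp (H - ∑ j, Matrix.vecMulVec (v (σ j)) (v (σ j)))).trace) := by
      intro σ
      have h1 := sum_mul_trace_exp_sub_vecMulVec_le hp0 hp1 hv hI
        (hH.sub (isHermitian_sum_vecMulVec Finset.univ fun j => v (σ j)))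
      have h2 := mul_le_mul_of_nonneg_left h1
        (Finset.prod_nonneg fun j (_ : j ∈ Finset.univ) => hp0 (σ j))
      rw [mul_left_comm]
      refine le_of_eq_of_le ?_ h2
      rw [Finset.mul_sum]
      refine Finset.sum_congr rfl fun i _ => ?_
      rw [Fin.prod_univ_succ, Fin.sum_univ_succ]
      simp only [Fin.cons_zero, Fin.cons_succ]
      rw [sub_sub, add_comm (∑ j, _)]
      ring
    refine (Finset.sum_le_sum fun σ _ => hstep σ).trans ?_
    rw [← Finset.mul_sum]
    refine (mul_le_mul_of_nonneg_left ih (Real.exp_pos _).le).trans_eq ?_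
    rw [← mul_assoc, ← Real.exp_add]
    push_cast
    ring_nf

/-! ### Markov's inequality and the two tail bounds -/

theorem sum_pi_mul_le_of_markov {ι : Type*} [Fintype ι] {w Ψ : ι → ℝ} (hw : ∀ i, 0 ≤ w i)
    (hΨ : ∀ i, 0 ≤ Ψ i) {G : Finset ι} {a b : ℝ} (ha : 0 < a) (hG : ∀ i ∈ G, a ≤ Ψ i)
    (hb : ∑ i, w i * Ψ i ≤ b) : ∑ i ∈ G, w i ≤ b / a := by
  rw [le_div_iff₀ ha, Finset.sum_mul]
  calc ∑ i ∈ G, w i * a ≤ ∑ i ∈ G, w i * Ψ i :=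
        Finset.sum_le_sum fun i hi => mul_le_mul_of_nonneg_left (hG i hi) (hw i)
    _ ≤ ∑ i, w i * Ψ i := Finset.sum_le_sum_of_subset_of_nonneg (Finset.subset_univ _)
        fun i _ _ => mul_nonneg (hw i) (hΨ i)
    _ ≤ b := hb

-- Exponential Markov for the trace of `exp (-θ ∑ v vᵀ)`, starting the iteration at `H = 0`, whose
-- trace exponential is the dimension.
open Classical in
theorem sum_pi_lower_tail_le {κ n : Type*} [Fintype κ] [Fintype n] [DecidableEq n]
    {p : κ → ℝ} (hp0 : ∀ i, 0 ≤ p i) (hp1 : ∑ i, p i = 1) {v : κ → n → ℝ} {L ε : ℝ} (hL : 0 < L)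
    (hε : 0 < ε) (hv : ∀ i, v i ⬝ᵥ v i ≤ L)
    (hI : ∑ i, p i • Matrix.vecMulVec (v i) (v i) = 1) (r : ℕ) :
    ∑ τ ∈ Finset.univ.filter (fun τ : Fin r → κ =>
        ∃ x : n → ℝ, ∑ j, (v (τ j) ⬝ᵥ x) ^ 2 < r * (1 - ε) * (x ⬝ᵥ x)), ∏ j, p (τ j)
      ≤ Fintype.card n * Real.exp (-(r * ε ^ 2 / (4 * L))) := by
  -- This `θ` minimizes the resulting exponent `r (θ² L - θ ε)`, with value `-r ε² / (4 L)`.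
  obtain ⟨θ, hθ⟩ : ∃ θ, θ = ε / (2 * L) := ⟨_, rfl⟩
  have hθ0 : 0 < θ := by rw [hθ]; positivity
  have hsq : √θ * √θ = θ := Real.mul_self_sqrt hθ0.le
  have hvv : ∀ i, Matrix.vecMulVec (√θ • v i) (√θ • v i) = θ • Matrix.vecMulVec (v i) (v i) := by
    intro i
    rw [Matrix.smul_vecMulVec, Matrix.vecMulVec_smul, smul_smul, hsq]
  have h1 := sum_pi_mul_trace_exp_le hp0 hp1 (v := fun i => √θ • v i) (s := θ * L) (c := θ)
    (fun i => by
      rw [smul_dotProduct, dotProduct_smul, smul_smul, hsq, smul_eq_mul]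
      exact mul_le_mul_of_nonneg_left (hv i) hθ0.le)
    (by
      simp_rw [hvv, smul_comm (p _) θ]
      rw [← Finset.smul_sum, hI]) r (H := 0) Matrix.isHermitian_zero
  have hS : ∀ τ : Fin r → κ,
      (0 - ∑ j, Matrix.vecMulVec (√θ • v (τ j)) (√θ • v (τ j))).IsHermitian := fun τ =>
    Matrix.isHermitian_zero.sub (isHermitian_sum_vecMulVec Finset.univ fun j => √θ • v (τ j))
  have h2 := sum_pi_mul_le_of_markov (fun τ : Fin r → κ => Finset.prod_nonneg fun j _ => hp0 (τ j))
    (fun τ => trace_exp_nonneg (hS τ)) (G := Finset.univ.filter (fun τ : Fin r → κ =>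
        ∃ x : n → ℝ, ∑ j, (v (τ j) ⬝ᵥ x) ^ 2 < r * (1 - ε) * (x ⬝ᵥ x)))
    (Real.exp_pos (-(θ * (r * (1 - ε))))) ?_ h1
  · refine h2.trans_eq ?_
    rw [NormedSpace.exp_zero, Matrix.trace_one, mul_div_right_comm, ← Real.exp_sub, mul_comm]
    congr 2
    rw [hθ]
    field_simp
    ring
  · intro τ hτ
    obtain ⟨x, hx⟩ := (Finset.mem_filter.1 hτ).2
    refine exp_le_trace_exp (hS τ) x _ ?_
    have : x ⬝ᵥ (0 - ∑ j, Matrix.vecMulVec (√θ • v (τ j)) (√θ • v (τ j))) *ᵥ x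
        = -(θ * ∑ j, (v (τ j) ⬝ᵥ x) ^ 2) := by
      rw [zero_sub, Matrix.neg_mulVec, dotProduct_neg, Matrix.sum_mulVec, dotProduct_sum,
        Finset.mul_sum]
      congr 1
      refine Finset.sum_congr rfl fun j _ => ?_
      rw [hvv, Matrix.smul_mulVec, dotProduct_smul, Matrix.vecMulVec_mulVec]
      simp [dotProduct_comm x, sq]
    rw [this]
    linarith [mul_lt_mul_of_pos_left hx hθ0]

open Classical in
theorem sum_pi_upper_tail_le {κ : Type*} [Fintype κ] {p : κ → ℝ} (hp0 : ∀ i, 0 ≤ p i)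
    (hp1 : ∑ i, p i = 1) {X : κ → ℝ} {L ε : ℝ} (hL : 0 < L) (hε : 0 < ε) (hε1 : ε ≤ 1)
    (hX0 : ∀ i, 0 ≤ X i) (hX : ∀ i, X i ≤ L) (hX1 : ∑ i, p i * X i = 1) (r : ℕ) :
    ∑ τ ∈ Finset.univ.filter (fun τ : Fin r → κ => r * (1 + ε) < ∑ j, X (τ j)), ∏ j, p (τ j)
      ≤ Real.exp (-(r * ε ^ 2 / (4 * L))) := by
  obtain ⟨θ, hθ⟩ : ∃ θ, θ = ε / (2 * L) := ⟨_, rfl⟩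
  have hθ0 : 0 < θ := by rw [hθ]; positivity
  have hθL : θ * L ≤ 1 := by rw [hθ]; field_simp; linarith
  have hmgf : ∑ i, p i * Real.exp (θ * X i) ≤ Real.exp (θ + θ ^ 2 * L) := by
    calc ∑ i, p i * Real.exp (θ * X i)
        ≤ ∑ i, (p i + (θ + θ ^ 2 * L) * (p i * X i)) := by
          refine Finset.sum_le_sum fun i _ => ?_
          have h0 : 0 ≤ θ * X i := mul_nonneg hθ0.le (hX0 i)
          have h1 : θ * X i ≤ 1 := (mul_le_mul_of_nonneg_left (hX i) hθ0.le).trans hθL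
          -- `exp x ≤ 1 + x + x²` for `|x| ≤ 1`; one factor of the square is then bounded through `X
          -- i ≤ L`, leaving an expression linear in `X i`.
          have h2 := (abs_le.1 (Real.abs_exp_sub_one_sub_id_le (abs_le.2 ⟨by linarith, h1⟩))).2
          have h3 : (θ * X i) ^ 2 ≤ θ ^ 2 * L * X i := by
            rw [mul_pow, sq (X i), ← mul_assoc]
            have := mul_le_mul_of_nonneg_left (hX i) (mul_nonneg (sq_nonneg θ) (hX0 i))
            linarith
          have h4 : Real.exp (θ * X i) ≤ 1 + (θ + θ ^ 2 * L) * X i := by linarith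
          linarith [mul_le_mul_of_nonneg_left h4 (hp0 i)]
      _ = (θ + θ ^ 2 * L) + 1 := by
          rw [Finset.sum_add_distrib, ← Finset.mul_sum, hX1, hp1]; ring
      _ ≤ _ := Real.add_one_le_exp _
  have h1 : ∑ τ : Fin r → κ, (∏ j, p (τ j)) * Real.exp (θ * ∑ j, X (τ j))
      ≤ Real.exp (θ + θ ^ 2 * L) ^ r := by
    refine le_of_eq_of_le ?_ (pow_le_pow_left₀ (Finset.sum_nonneg fun i _ =>
      mul_nonneg (hp0 i) (Real.exp_pos _).le) hmgf r)
    rw [Fintype.sum_pow]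
    refine Finset.sum_congr rfl fun τ _ => ?_
    rw [Finset.mul_sum, Real.exp_sum, Finset.prod_mul_distrib]
  refine (sum_pi_mul_le_of_markov (fun τ => Finset.prod_nonneg fun j _ => hp0 (τ j))
    (fun τ => (Real.exp_pos _).le) (Real.exp_pos (θ * (r * (1 + ε)))) (fun τ hτ =>
      Real.exp_le_exp.2 (mul_le_mul_of_nonneg_left (Finset.mem_filter.1 hτ).2.le hθ0.le))
      h1).trans_eq ?_
  rw [← Real.exp_nat_mul, ← Real.exp_sub]
  congr 1
  rw [hθ]
  field_simp
  ring

/-! ### Least-squares geometry, row sampling and passage to probability -/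

theorem euclNorm_eq_sqrt {m : ℕ} (v : Fin m → ℝ) : euclNorm v = √(v ⬝ᵥ v) := by
  rw [euclNorm, EuclideanSpace.norm_eq]
  simp [dotProduct, sq]

theorem dotProduct_self_nonneg_real {ι : Type*} [Fintype ι] (v : ι → ℝ) : 0 ≤ v ⬝ᵥ v :=
  Finset.sum_nonneg fun i _ => mul_self_nonneg (v i)

theorem mulVec_dotProduct_self {ι n : Type*} [Fintype ι] [Fintype n] [DecidableEq n]
    {W : Matrix ι n ℝ} (hW : Wᵀ * W = 1) (x : n → ℝ) : (W *ᵥ x) ⬝ᵥ (W *ᵥ x) = x ⬝ᵥ x := by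
  rw [Matrix.dotProduct_mulVec, ← Matrix.mulVec_transpose, Matrix.mulVec_mulVec, hW,
    Matrix.one_mulVec]

theorem transpose_mulVec_sub_mulVec_pinv {m n : ℕ} (B : Matrix (Fin m) (Fin n) ℝ)
    (b : Fin m → ℝ) : Bᵀ *ᵥ (b - B *ᵥ (pinv B *ᵥ b)) = 0 := by
  have h := pinv_isMoorePenrose B
  have h1 : Bᵀ * B * pinv B = Bᵀ := by
    rw [Matrix.mul_assoc, ← h.symm_left, ← Matrix.transpose_mul, h.mul_mul_self]
  rw [Matrix.mulVec_sub, Matrix.mulVec_mulVec, Matrix.mulVec_mulVec, h1, sub_self]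

/-- Pythagoras: by the normal equations the residual is orthogonal to the range of `B`. -/
theorem euclNorm_mulVec_pinv_sub_le {m n : ℕ} (B : Matrix (Fin m) (Fin n) ℝ) (b : Fin m → ℝ)
    (x : Fin n → ℝ) : euclNorm (B *ᵥ (pinv B *ᵥ b) - b) ≤ euclNorm (B *ᵥ x - b) := by
  rw [euclNorm_eq_sqrt, euclNorm_eq_sqrt]
  refine Real.sqrt_le_sqrt ?_
  obtain ⟨z, hz⟩ : ∃ z, z = x - pinv B *ᵥ b := ⟨_, rfl⟩
  obtain ⟨e, he⟩ : ∃ e, e = b - B *ᵥ (pinv B *ᵥ b) := ⟨_, rfl⟩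
  have h0 : (B *ᵥ z) ⬝ᵥ e = 0 := by
    rw [dotProduct_comm, Matrix.dotProduct_mulVec, ← Matrix.mulVec_transpose, he,
      transpose_mulVec_sub_mulVec_pinv, zero_dotProduct]
  have h1 : B *ᵥ x - b = B *ᵥ z - e := by
    rw [hz, he, Matrix.mulVec_sub]; abel
  have h2 : B *ᵥ (pinv B *ᵥ b) - b = -e := by rw [he]; abel
  rw [h1, h2, neg_dotProduct_neg, sub_dotProduct, dotProduct_sub, dotProduct_sub, h0,
    dotProduct_comm e (B *ᵥ z), h0]
  linarith [dotProduct_self_nonneg_real (B *ᵥ z)]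

theorem rowSamplingMatrix_mulVec_dotProduct_self {m r : ℕ} {p : Fin m → ℝ} (hp : ∀ i, 0 ≤ p i)
    (τ : Fin r → Fin m) (u : Fin m → ℝ) :
    (rowSamplingMatrix p τ *ᵥ u) ⬝ᵥ (rowSamplingMatrix p τ *ᵥ u)
      = (∑ j, u (τ j) ^ 2 / p (τ j)) / r := by
  rw [dotProduct, Finset.sum_div]
  refine Finset.sum_congr rfl fun j _ => ?_
  have h1 : (rowSamplingMatrix p τ *ᵥ u) j = 1 / √(r * p (τ j)) * u (τ j) := by
    simp [rowSamplingMatrix, Matrix.mulVec, dotProduct]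
  have h2 : √(r * p (τ j)) * √(r * p (τ j)) = r * p (τ j) :=
    Real.mul_self_sqrt (mul_nonneg (Nat.cast_nonneg r) (hp _))
  rw [h1, div_div, mul_comm (p (τ j)), mul_mul_mul_comm, div_mul_div_comm, h2]
  ring

/-- The extra column is `e / ‖e‖`. If `e = 0` no column is needed, and the quotient in the row norms
is `0` by the convention on division. -/
theorem exists_orthonormal_extension {m d : ℕ} {U : Matrix (Fin m) (Fin d) ℝ} (hU : Uᵀ * U = 1)
    {e : Fin m → ℝ} (he : Uᵀ *ᵥ e = 0) :
    ∃ (n : Type) (_ : Fintype n) (_ : DecidableEq n) (W : Matrix (Fin m) n ℝ),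
      Fintype.card n ≤ d + 1 ∧ Wᵀ * W = 1 ∧ (∀ z, ∃ x, U *ᵥ z - e = W *ᵥ x) ∧
      ∀ i, W i ⬝ᵥ W i = U i ⬝ᵥ U i + e i ^ 2 / (e ⬝ᵥ e) := by
  by_cases h0 : e = 0
  · exact ⟨Fin d, inferInstance, inferInstance, U, by simp, hU, fun z => ⟨z, by simp [h0]⟩,
      fun i => by simp [h0]⟩
  · have hpos : 0 < e ⬝ᵥ e := lt_of_le_of_ne (dotProduct_self_nonneg_real e)
      fun h => h0 (dotProduct_self_eq_zero.1 h.symm)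
    obtain ⟨s, hs⟩ : ∃ s, s = √(e ⬝ᵥ e) := ⟨_, rfl⟩
    have hs0 : 0 < s := by rw [hs]; exact Real.sqrt_pos.2 hpos
    have hss : s * s = e ⬝ᵥ e := by rw [hs]; exact Real.mul_self_sqrt hpos.le
    refine ⟨Fin d ⊕ Unit, inferInstance, inferInstance,
      Matrix.fromCols U (Matrix.replicateCol Unit (s⁻¹ • e)), by simp, ?_, fun z => ?_, fun i => ?_⟩
    · have h1 : Uᵀ * Matrix.replicateCol Unit (s⁻¹ • e) = 0 := by
        rw [← Matrix.replicateCol_mulVec, Matrix.mulVec_smul, he, smul_zero,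
          Matrix.replicateCol_zero]
      have h2 : (Matrix.replicateCol Unit (s⁻¹ • e))ᵀ * U = 0 := by
        rw [← Matrix.transpose_transpose U, ← Matrix.transpose_mul, h1, Matrix.transpose_zero]
      have h3 : (Matrix.replicateCol Unit (s⁻¹ • e))ᵀ * Matrix.replicateCol Unit (s⁻¹ • e) = 1 := by
        ext a b
        have : (s⁻¹ • e) ⬝ᵥ (s⁻¹ • e) = 1 := by
          rw [smul_dotProduct, dotProduct_smul, ← hss]
          simp only [smul_eq_mul]
          field_simp
        simpa [Matrix.mul_apply, Matrix.replicateCol_apply, dotProduct] using this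
      rw [Matrix.transpose_fromCols, Matrix.fromRows_mul_fromCols, hU, h1, h2, h3,
        Matrix.fromBlocks_one]
    · refine ⟨Sum.elim z fun _ => -s, ?_⟩
      rw [Matrix.fromCols_mulVec]
      ext i
      simp [Matrix.mulVec, dotProduct, Matrix.replicateCol_apply]
      field_simp
      ring
    · rw [← hss]
      simp [dotProduct, Matrix.replicateCol_apply]
      field_simp

/-- By independence the tuple of samples has the product law, so the finite weighted sums of the
tail bounds are probabilities. -/
theorem one_sub_sum_le_measureReal {κ : Type*} [Fintype κ] [MeasurableSpace κ]
    [MeasurableSingletonClass κ] {r : ℕ} {p : κ → ℝ} {Ω : Type*} [MeasurableSpace Ω]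
    (P : MeasureTheory.Measure Ω) [MeasureTheory.IsProbabilityMeasure P] {t : Fin r → Ω → κ}
    (ht_meas : ∀ j, Measurable (t j)) (ht_indep : ProbabilityTheory.iIndepFun t P)
    (ht_law : ∀ j i, P.real {ω | t j ω = i} = p i) (G : Set (Fin r → κ))
    (B : Finset (Fin r → κ)) (hGB : ∀ τ ∉ B, τ ∈ G) :
    1 - ∑ τ ∈ B, ∏ j, p (τ j) ≤ P.real {ω | (fun j => t j ω) ∈ G} := by
  have hT : Measurable fun ω j => t j ω := measurable_pi_lambda _ ht_meas
  have hB : P.real ((fun ω j => t j ω) ⁻¹' (B : Set (Fin r → κ))) = ∑ τ ∈ B, ∏ j, p (τ j) := by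
    rw [← MeasureTheory.sum_measureReal_preimage_singleton B
      fun τ _ => hT (measurableSet_singleton τ)]
    refine Finset.sum_congr rfl fun τ _ => ?_
    have h1 := ht_indep.measure_inter_preimage_eq_mul Finset.univ (sets := fun j => {τ j})
      fun j _ => measurableSet_singleton _
    have h2 : (fun ω j => t j ω) ⁻¹' {τ} = ⋂ j ∈ Finset.univ, t j ⁻¹' {τ j} := by
      ext ω; simp [funext_iff]
    rw [h2, MeasureTheory.measureReal_def, h1, ENNReal.toReal_prod]
    exact Finset.prod_congr rfl fun j _ => ht_law j (τ j)
  rw [← hB, ← MeasureTheory.probReal_compl_eq_one_sub (hT B.measurableSet)]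
  exact MeasureTheory.measureReal_mono fun ω hω => hGB _ hω

theorem sum_smul_vecMulVec_whitened {ι n : Type*} [Fintype ι] [Fintype n] [DecidableEq n]
    {W : Matrix ι n ℝ} (hW : Wᵀ * W = 1) {p : ι → ℝ} (hp0 : ∀ i, 0 ≤ p i) {L : ℝ}
    (hL : ∀ i, W i ⬝ᵥ W i ≤ L * p i) :
    ∑ i, p i • Matrix.vecMulVec ((√(p i))⁻¹ • W i) ((√(p i))⁻¹ • W i) = 1 := by
  rw [← hW]
  ext a b
  rw [Matrix.sum_apply, Matrix.mul_apply]
  refine Finset.sum_congr rfl fun i _ => ?_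
  rcases (hp0 i).eq_or_lt with h | h
  · have h1 : W i = 0 := by
      have := hL i
      rw [← h, mul_zero] at this
      exact dotProduct_self_eq_zero.1 (le_antisymm this (dotProduct_self_nonneg_real _))
    simp [h1]
  · have h2 : √(p i) * √(p i) = p i := Real.mul_self_sqrt (hp0 i)
    have h3 : 0 < √(p i) := Real.sqrt_pos.2 h
    simp only [Matrix.smul_apply, Matrix.vecMulVec_apply, Pi.smul_apply, smul_eq_mul,
      Matrix.transpose_apply]
    nth_rw 1 [← h2]
    field_simp

theorem euclNorm_sampledRegression_sub_le {m d r : ℕ} {Q : Matrix (Fin r) (Fin m) ℝ}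
    {A : Matrix (Fin m) (Fin d) ℝ} {y : Fin m → ℝ} {ε : ℝ} (hε0 : 0 < ε) (hε1 : ε < 1)
    (hlow : ∀ x : Fin d → ℝ, (1 - ε) * ((A *ᵥ x - y) ⬝ᵥ (A *ᵥ x - y))
      ≤ (Q *ᵥ (A *ᵥ x - y)) ⬝ᵥ (Q *ᵥ (A *ᵥ x - y)))
    (hup : (Q *ᵥ lsResidual A y) ⬝ᵥ (Q *ᵥ lsResidual A y)
      ≤ (1 + ε) * (lsResidual A y ⬝ᵥ lsResidual A y)) :
    euclNorm (A *ᵥ sampledRegression Q A y - y)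
      ≤ (1 + ε + ε * √((1 + ε) / (1 - ε))) * euclNorm (A *ᵥ (pinv A *ᵥ y) - y) := by
  have hε : 0 < 1 - ε := by linarith
  have hres : A *ᵥ (pinv A *ᵥ y) - y = -lsResidual A y := by rw [lsResidual]; abel
  have h1 := euclNorm_mulVec_pinv_sub_le (Q * A) (Q *ᵥ y) (pinv A *ᵥ y)
  rw [euclNorm_eq_sqrt, euclNorm_eq_sqrt, Real.sqrt_le_sqrt_iff (dotProduct_self_nonneg_real _),
    ← Matrix.mulVec_mulVec, ← Matrix.mulVec_mulVec, ← Matrix.mulVec_sub, ← Matrix.mulVec_sub, hres,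
    Matrix.mulVec_neg, neg_dotProduct_neg] at h1
  have h2 := (hlow (sampledRegression Q A y)).trans (h1.trans hup)
  -- Write `s` for the root. Since `s² ≥ 1`, `s ≤ s² = (1 + ε) / (1 - ε)`; clearing the denominator
  -- gives `s ≤ 1 + ε + ε s`.
  have hs : √((1 + ε) / (1 - ε)) ≤ 1 + ε + ε * √((1 + ε) / (1 - ε)) := by
    have h3 : √((1 + ε) / (1 - ε)) ≤ (1 + ε) / (1 - ε) := by
      refine Real.sqrt_le_iff.2 ⟨by positivity, le_self_pow₀ ?_ two_ne_zero⟩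
      rw [le_div_iff₀ hε]
      linarith
    rw [le_div_iff₀ hε] at h3
    linarith
  refine le_trans ?_ (mul_le_mul_of_nonneg_right hs (norm_nonneg _))
  rw [euclNorm_eq_sqrt, euclNorm_eq_sqrt, hres, neg_dotProduct_neg,
    ← Real.sqrt_mul (by positivity)]
  refine Real.sqrt_le_sqrt ?_
  rw [div_mul_eq_mul_div, le_div_iff₀ hε]
  linarith

/-! ### Assembly -/

theorem mainTheorem6 {m d r : ℕ}
    -- the regression problem and a singular value decomposition of the data matrix
    (A : Matrix (Fin m) (Fin d) ℝ) (y : Fin m → ℝ)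
    (U : Matrix (Fin m) (Fin d) ℝ) (σ : Fin d → ℝ) (V : Matrix (Fin d) (Fin d) ℝ)
    (hSVD : IsSVD A U σ V)
    -- the parameters
    (β ε δ : ℝ) (hβ0 : 0 < β) (hβ1 : β ≤ 1) (hε0 : 0 < ε) (hε1 : ε < 1) (hδ : 0 < δ)
    -- the sampling probabilities
    (p : Fin m → ℝ) (hp0 : ∀ i, 0 ≤ p i) (hp1 : ∑ i, p i = 1)
    (hp : ∀ i, p i ≥ β * ((U i ⬝ᵥ U i) / d
      + ((U i ⬝ᵥ U i) + lsResidual A y i ^ 2 / (lsResidual A y ⬝ᵥ lsResidual A y)) / (d + 1)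
      + lsResidual A y i ^ 2 / (lsResidual A y ⬝ᵥ lsResidual A y)))
    -- the number of samples
    (hr : (r : ℝ) ≥ 8 * (d + 1) / (β * ε ^ 2) * Real.log (2 * (d + 1) / δ))
    -- the sampled row indices are i.i.d. with distribution `p`
    {Ω : Type*} [MeasurableSpace Ω] (P : MeasureTheory.Measure Ω)
    [MeasureTheory.IsProbabilityMeasure P]
    (t : Fin r → Ω → Fin m) (ht_meas : ∀ j, Measurable (t j))
    (ht_indep : ProbabilityTheory.iIndepFun t P)
    (ht_law : ∀ j i, P.real {ω | t j ω = i} = p i) :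
    (∀ x : Fin d → ℝ, euclNorm (A *ᵥ (pinv A *ᵥ y) - y) ≤ euclNorm (A *ᵥ x - y)) ∧
    P.real {ω | euclNorm
        (A *ᵥ sampledRegression (rowSamplingMatrix p (fun j => t j ω)) A y - y) ≤
      (1 + ε + ε * √((1 + ε) / (1 - ε))) * euclNorm (A *ᵥ (pinv A *ᵥ y) - y)} ≥ 1 - 3 * δ := by
  classical
  refine ⟨euclNorm_mulVec_pinv_sub_le A y, ?_⟩
  -- For `δ ≥ 1` the probability bound is trivial; `δ < 1` is needed for a positive logarithm and
  -- for `δ² ≤ δ`.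
  rcases le_or_gt 1 δ with hδ1 | hδ1
  · exact le_trans (by linarith) MeasureTheory.measureReal_nonneg
  obtain ⟨e, he⟩ : ∃ e, e = lsResidual A y := ⟨_, rfl⟩
  rw [← he] at hp
  have hd1 : (1 : ℝ) ≤ (d : ℝ) + 1 := by linarith [Nat.cast_nonneg (α := ℝ) d]
  have hlog : 0 < Real.log (2 * (d + 1) / δ) := by
    refine Real.log_pos ?_
    rw [lt_div_iff₀ hδ]
    linarith
  have hr0 : (0 : ℝ) < r := lt_of_lt_of_le (by positivity) hr
  obtain ⟨L, hL⟩ : ∃ L : ℝ, L = (d + 1) / β := ⟨_, rfl⟩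
  have hL0 : 0 < L := by rw [hL]; positivity
  -- The constant `8` makes the exponent at least twice the logarithm. The resulting square absorbs
  -- the dimension factor `d + 1`.
  have htail : Real.exp (-(r * ε ^ 2 / (4 * L))) ≤ (δ / (2 * (d + 1))) ^ 2 := by
    have h1 : 2 * Real.log (2 * (d + 1) / δ) ≤ r * ε ^ 2 / (4 * L) := by
      rw [ge_iff_le, div_mul_eq_mul_div, div_le_iff₀ (by positivity)] at hr
      rw [hL, le_div_iff₀ (by positivity)]
      have h2 : 2 * Real.log (2 * (d + 1) / δ) * (4 * ((d + 1) / β))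
          = (8 * (d + 1) * Real.log (2 * (d + 1) / δ)) / β := by ring
      rw [h2, div_le_iff₀ hβ0]
      linarith
    calc Real.exp (-(r * ε ^ 2 / (4 * L))) ≤ Real.exp (-(2 * Real.log (2 * (d + 1) / δ))) :=
          Real.exp_le_exp.2 (neg_le_neg h1)
      _ = (δ / (2 * (d + 1))) ^ 2 := by
          rw [← mul_neg, ← Real.log_inv, inv_div, ← Real.log_rpow (by positivity),
            Real.exp_log (by positivity)]
          norm_cast
  have hδ2 : (d + 1) * (δ / (2 * (d + 1))) ^ 2 ≤ δ := by
    rw [div_pow, ← mul_div_assoc, div_le_iff₀ (by positivity)]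
    have h1 : (d + 1) * δ ^ 2 ≤ (d + 1) * δ := by
      refine mul_le_mul_of_nonneg_left ?_ (by linarith)
      rw [sq]
      exact mul_le_of_le_one_left hδ.le hδ1.le
    have h2 : ((d : ℝ) + 1) ≤ (2 * (d + 1)) ^ 2 := by nlinarith
    nlinarith [mul_le_mul_of_nonneg_left h2 hδ.le]
  -- `A x - y` lies in the column space of an orthonormal matrix `W` extending `U`
  have hUA : U = A * V * Matrix.diagonal (fun i => (σ i)⁻¹) := by
    have h1 : A * V = U * Matrix.diagonal σ := by
      rw [hSVD.eq, Matrix.mul_assoc _ Vᵀ V, hSVD.orthogonal_right, Matrix.mul_one]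
    rw [h1, Matrix.mul_assoc, Matrix.diagonal_mul_diagonal]
    simp [(hSVD.pos _).ne']
  have hUe : Uᵀ *ᵥ e = 0 := by
    rw [hUA, Matrix.transpose_mul, Matrix.transpose_mul, ← Matrix.mulVec_mulVec,
      ← Matrix.mulVec_mulVec, he, lsResidual, transpose_mulVec_sub_mulVec_pinv]
    simp
  obtain ⟨n, _, _, W, hcard, hWW, hWran, hWrow⟩ :=
    exists_orthonormal_extension hSVD.orthonormal_left hUe
  have hcol : ∀ x, ∃ z, A *ᵥ x - y = W *ᵥ z := by
    intro x
    obtain ⟨z, hz⟩ := hWran (Matrix.diagonal σ *ᵥ (Vᵀ *ᵥ (x - pinv A *ᵥ y)))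
    refine ⟨z, ?_⟩
    rw [← hz, Matrix.mulVec_mulVec, Matrix.mulVec_mulVec, ← hSVD.eq, he,
      lsResidual, Matrix.mulVec_sub]
    abel
  have hq0 : ∀ i, 0 ≤ e i ^ 2 / (e ⬝ᵥ e) := fun i =>
    div_nonneg (sq_nonneg _) (dotProduct_self_nonneg_real e)
  have hu0 : ∀ i, 0 ≤ U i ⬝ᵥ U i := fun i => dotProduct_self_nonneg_real _
  have hpW : ∀ i, W i ⬝ᵥ W i ≤ L * p i := by
    intro i
    -- The middle summand of the sampling condition is exactly `‖W i‖² / (d + 1)`.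
    have h1 : β * ((U i ⬝ᵥ U i + e i ^ 2 / (e ⬝ᵥ e)) / (d + 1)) ≤ p i :=
      (mul_le_mul_of_nonneg_left (by
        linarith [hq0 i, div_nonneg (hu0 i) (Nat.cast_nonneg (α := ℝ) d)]) hβ0.le).trans (hp i)
    rw [hWrow, hL]
    refine le_of_eq_of_le ?_ (mul_le_mul_of_nonneg_left h1 (by positivity))
    field_simp
  have hsq : ∀ i, (√(p i))⁻¹ * (√(p i))⁻¹ = (p i)⁻¹ := fun i => by
    rw [← mul_inv, Real.mul_self_sqrt (hp0 i)]
  have hlow := sum_pi_lower_tail_le hp0 hp1 (v := fun i => (√(p i))⁻¹ • W i) hL0 hε0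
    (fun i => by
      rw [smul_dotProduct, dotProduct_smul, smul_smul, hsq, smul_eq_mul]
      rcases (hp0 i).eq_or_lt with h | h
      · rw [← h, inv_zero, zero_mul]; exact hL0.le
      · rw [inv_mul_le_iff₀ h, mul_comm]; exact hpW i)
    (sum_smul_vecMulVec_whitened hWW hp0 hpW) r
  have hlowδ := hlow.trans ((mul_le_mul (by exact_mod_cast hcard) htail (Real.exp_pos _).le
    (by positivity)).trans hδ2)
  obtain ⟨B, hB, hBup⟩ : ∃ B : Finset (Fin r → Fin m), ∑ τ ∈ B, ∏ j, p (τ j) ≤ δ ∧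
      ∀ τ ∉ B, ∑ j, e (τ j) ^ 2 / p (τ j) ≤ r * (1 + ε) * (e ⬝ᵥ e) := by
    by_cases h0 : e = 0
    · exact ⟨∅, by simpa using hδ.le, fun τ _ => by simp [h0]⟩
    have hpos : 0 < e ⬝ᵥ e := lt_of_le_of_ne (dotProduct_self_nonneg_real e)
      fun h => h0 (dotProduct_self_eq_zero.1 h.symm)
    have hpe : ∀ i, e i ^ 2 / (e ⬝ᵥ e) ≤ L * p i := fun i =>
      (le_add_of_nonneg_left (hu0 i)).trans ((hWrow i).symm.trans_le (hpW i))
    have hup := sum_pi_upper_tail_le hp0 hp1 (X := fun i => e i ^ 2 / (e ⬝ᵥ e) / p i) hL0 hε0 hε1.le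
      (fun i => div_nonneg (hq0 i) (hp0 i))
      (fun i => by
        rcases (hp0 i).eq_or_lt with h | h
        · rw [← h, div_zero]; exact hL0.le
        · rw [div_le_iff₀ h]; exact hpe i)
      (by
        have h1 : ∀ i, p i * (e i ^ 2 / (e ⬝ᵥ e) / p i) = e i ^ 2 / (e ⬝ᵥ e) := fun i => by
          rcases (hp0 i).eq_or_lt with h | h
          · have h2 := hpe i
            rw [← h, mul_zero] at h2
            rw [← h, zero_mul, le_antisymm h2 (hq0 i)]
          · field_simp
        simp_rw [h1]
        rw [← Finset.sum_div, div_eq_one_iff_eq hpos.ne', dotProduct]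
        simp_rw [sq]) r
    refine ⟨_, hup.trans (htail.trans ((le_mul_of_one_le_left (sq_nonneg _) hd1).trans hδ2)),
      fun τ hτ => ?_⟩
    simp only [Finset.mem_filter, Finset.mem_univ, true_and, not_lt] at hτ
    have h1 : ∑ j, e (τ j) ^ 2 / (e ⬝ᵥ e) / p (τ j)
        = (∑ j, e (τ j) ^ 2 / p (τ j)) / (e ⬝ᵥ e) := by
      rw [Finset.sum_div]
      exact Finset.sum_congr rfl fun j _ => div_right_comm _ _ _
    rwa [h1, div_le_iff₀ hpos] at hτ
  refine le_trans ?_ (one_sub_sum_le_measureReal P ht_meas ht_indep ht_law {τ | euclNorm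
        (A *ᵥ sampledRegression (rowSamplingMatrix p τ) A y - y) ≤
      (1 + ε + ε * √((1 + ε) / (1 - ε))) * euclNorm (A *ᵥ (pinv A *ᵥ y) - y)}
    (Finset.univ.filter (fun τ : Fin r → Fin m => ∃ x : n → ℝ,
      ∑ j, ((√(p (τ j)))⁻¹ • W (τ j) ⬝ᵥ x) ^ 2 < r * (1 - ε) * (x ⬝ᵥ x)) ∪ B) fun τ hτ => ?_)
  -- Union bound: the two bad sets have total weight at most `2 δ`, within the allowed `3 δ`.
  · have h1 := Finset.sum_union_inter (s₁ := Finset.univ.filter (fun τ : Fin r → Fin m =>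
      ∃ x : n → ℝ, ∑ j, ((√(p (τ j)))⁻¹ • W (τ j) ⬝ᵥ x) ^ 2 < r * (1 - ε) * (x ⬝ᵥ x))) (s₂ := B)
      (f := fun τ => ∏ j, p (τ j))
    have h2 : 0 ≤ ∑ τ ∈ Finset.univ.filter (fun τ : Fin r → Fin m => ∃ x : n → ℝ,
        ∑ j, ((√(p (τ j)))⁻¹ • W (τ j) ⬝ᵥ x) ^ 2 < r * (1 - ε) * (x ⬝ᵥ x)) ∩ B, ∏ j, p (τ j) :=
      Finset.sum_nonneg fun τ _ => Finset.prod_nonneg fun j _ => hp0 _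
    linarith
  · rw [Finset.mem_union, not_or] at hτ
    obtain ⟨hτ1, hτ2⟩ := hτ
    simp only [Finset.mem_filter, Finset.mem_univ, true_and, not_exists, not_lt] at hτ1
    refine euclNorm_sampledRegression_sub_le hε0 hε1 (fun x => ?_) ?_
    · obtain ⟨z, hz⟩ := hcol x
      rw [hz, rowSamplingMatrix_mulVec_dotProduct_self hp0, mulVec_dotProduct_self hWW,
        le_div_iff₀ hr0]
      have h1 := hτ1 z
      have h2 : ∀ j, ((√(p (τ j)))⁻¹ • W (τ j) ⬝ᵥ z) ^ 2 = (W *ᵥ z) (τ j) ^ 2 / p (τ j) := by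
        intro j
        rw [smul_dotProduct, smul_eq_mul, mul_pow, sq (√(p (τ j)))⁻¹, hsq, Matrix.mulVec]
        ring
      simp_rw [h2] at h1
      linarith
    · rw [← he, rowSamplingMatrix_mulVec_dotProduct_self hp0, div_le_iff₀ hr0]
      linarith [hBup τ hτ2]
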